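/- Let $n$ be a positive integer and let $F$ be a field. In the field $F(x_1,\ldots,x_{2n})$ of rational functions in the variables $x_1,\ldots,x_{2n}$, let $S(x_1,\ldots,x_{2n})$ be the permanent of the $2n\times 2n$ matrix $[x_{j,k}]_{1\le j,k\le 2n}$ with $x_{j,j}=1$ and $x_{j,k}=(x_j+x_k)/(x_j-x_k)$ for $j\ne k$; that is, $$S(x_1,\ldots,x_{2n})=\sum_{\tau\in S_{2n}}\ \prod_{\substack{1\le j\le 2n\\ \tau(j)\ne j}}\frac{x_j+x_{\tau(j)}}{x_j-x_{\tau(j)}},$$ where $S_{2n}$ is the group of permutations of $\{1,\ldots,2n\}$ and an empty product is $1$. Then $$S(x_1,\ldots,x_{2n})=(-4)^n\,x_1x_2\cdots x_{2n}\sum_{\{\{i_1,j_1\},\ldots,\{i_n,j_n\}\}}\ \prod_{k=1}^n\frac{1}{(x_{i_k}-x_{j_k})^2},$$ where the sum runs over all partitions of $\{1,\ldots,2n\}$ into $n$ (unordered) pairs $\{i_k,j_k\}$. The same identity holds whenever $x_1,\ldots,x_{2n}$ are pairwise distinct elements of $F$. -/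

import Mathlib

/-- The matrix `[x_{j,k}]` with `x_{j,k} = (x_j + x_k) / (x_j - x_k)` for `j ≠ k` and
`x_{j,j} = 1`. -/
def quotientMatrix {ι K : Type*} [DecidableEq ι] [Field K] (x : ι → K) : Matrix ι ι K :=
  Matrix.of fun j k => if j = k then 1 else (x j + x k) / (x j - x k)

/-- `S(x)`, the permanent of the matrix `[x_{j,k}]`. -/
def permS {ι K : Type*} [DecidableEq ι] [Fintype ι] [Field K] (x : ι → K) : K :=
  (quotientMatrix x).permanent

/-- A partition of `ι` into pairs: a finite set of unordered pairs of distinct elements such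
that every element of `ι` lies in exactly one of the pairs. -/
def IsPairing {ι : Type*} (M : Finset (Sym2 ι)) : Prop :=
  (∀ e ∈ M, ¬ e.IsDiag) ∧ ∀ i : ι, ∃! e : Sym2 ι, e ∈ M ∧ i ∈ e

open Classical in
/-- The finite set of all partitions of `ι` into pairs. -/
noncomputable def pairings (ι : Type*) [Fintype ι] : Finset (Finset (Sym2 ι)) :=
  Finset.univ.filter fun M => IsPairing M

/-- The weight `1 / (x_i - x_j) ^ 2` of the unordered pair `{i, j}`. -/
def pairWeight {ι K : Type*} [Field K] (x : ι → K) (e : Sym2 ι) : K :=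
  Sym2.lift ⟨fun i j => 1 / (x i - x j) ^ 2, fun i j => by
    simp only [sub_sq_comm (x i) (x j)]⟩ e

/-- The variables `x_1, …, x_m`, as elements of the field of rational functions in `m` variables
over `F`. -/
noncomputable def ratVar (F : Type*) [Field F] (m : ℕ) (i : Fin m) :
    FractionRing (MvPolynomial (Fin m) F) :=
  algebraMap (MvPolynomial (Fin m) F) (FractionRing (MvPolynomial (Fin m) F)) (MvPolynomial.X i)

/-!
Write `c j k = (x j + x k) / (x j - x k)`. For a finite set `A` of indices, let `P_A(t)` be the
permanent over `A` of the matrix with entries `c j k + t` off the diagonal and `1 + t` on it, a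
polynomial in `t` with `P_A(0) = S(x_j : j ∈ A)`. Every permutation of `A ∪ {a}` arises from a
permutation `σ` of `A` either by fixing `a` or by inserting `a` between some `j` and `k = σ j`.
For `j ≠ k` the addition formula for `coth` gives
`(c a k + t) (c j a + t) = t² - 1 + (c j k + t) (c a k - c a j)`,
while for `j = k` the left side is `t² - 1 - 4 x_a x_j / (x_a - x_j)²`. Summed over `j`, the
terms `c a (σ j) - c a j` cancel, and since each entry has derivative `1` the terms `t² - 1`
produce a derivative (`shiftedPerm_insert`):
`P_{A ∪ {a}} = (1 + t) P_A + (t² - 1) P_A' - 4 ∑_j x_a x_j / (x_a - x_j)² P_{A ∖ {j}}`.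

The sum `M(A)` over the pairings of `A`, with weight `-4 x_i x_j / (x_i - x_j)²` for the pair
`{i, j}`, satisfies the analogous recursion without the first two terms (`pairingSum_insert`).
By induction `P_A = M(A) + (1 + t) F_A`, where only powers of `t` of parity opposite to that of
`#A` occur in `F_A` (`exists_shiftedPerm_eq`). If `#A` is even, then `F_A(0) = 0`, whence
`P_A(0) = M(A)`. Keeping track of coefficients rather than of `F_A(-t) = ± F_A(t)` makes the
argument work in characteristic two as well. The identity for rational functions is the case of
the distinct elements `x_1, …, x_{2n}` of the field of rational functions.
-/

open Polynomial

/-! ### Sums over pairings of a finite set -/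

open Classical in
/-- The partitions into pairs of a finite subset `A` of `ι`: sets of non-diagonal unordered pairs
of elements of `A` such that every element of `A` lies in exactly one of them. -/
noncomputable def pairingsOn {ι : Type*} [Fintype ι] (A : Finset ι) :
    Finset (Finset (Sym2 ι)) :=
  Finset.univ.filter fun M =>
    (∀ e ∈ M, ¬ e.IsDiag ∧ ∀ i ∈ e, i ∈ A) ∧ ∀ i ∈ A, ∃! e : Sym2 ι, e ∈ M ∧ i ∈ e

/-- The sum over all pairings of `A` of the product of the weights `f e` of their pairs. -/
noncomputable def pairingSum {ι R : Type*} [Fintype ι] [CommSemiring R] (f : Sym2 ι → R)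
    (A : Finset ι) : R :=
  ∑ M ∈ pairingsOn A, ∏ e ∈ M, f e

theorem exists_insert_eq {ι : Type*} [DecidableEq ι] {A : Finset ι} {a : ι} (ha : a ∈ A) :
    ∃ B, a ∉ B ∧ insert a B = A :=
  ⟨A.erase a, Finset.notMem_erase a A, Finset.insert_erase ha⟩

section Pairings

variable {ι : Type*} [Fintype ι]

theorem mem_pairingsOn {A : Finset ι} {M : Finset (Sym2 ι)} :
    M ∈ pairingsOn A ↔ (∀ e ∈ M, ¬ e.IsDiag ∧ ∀ i ∈ e, i ∈ A) ∧
      ∀ i ∈ A, ∃! e : Sym2 ι, e ∈ M ∧ i ∈ e := by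
  simp [pairingsOn]

theorem pairingsOn_univ : pairingsOn (Finset.univ : Finset ι) = pairings ι := by
  ext M
  classical
  refine mem_pairingsOn.trans (Iff.trans ?_ Finset.mem_filter.symm)
  simp [IsPairing]

theorem pairingsOn_empty : pairingsOn (∅ : Finset ι) = {∅} := by
  ext M
  rw [mem_pairingsOn, Finset.mem_singleton]
  constructor
  · rintro ⟨h, -⟩
    refine Finset.eq_empty_of_forall_notMem fun e he => ?_
    induction e with
    | _ i j => simpa using (h _ he).2 i (by simp)
  · rintro rfl
    simp

theorem notMem_of_mem_pairingsOn {A : Finset ι} {a j : ι} (ha : a ∉ A)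
    {M : Finset (Sym2 ι)} (hM : M ∈ pairingsOn A) : s(a, j) ∉ M := fun h =>
  ha (((mem_pairingsOn.1 hM).1 _ h).2 a (by simp))

variable {R : Type*} [CommSemiring R]

theorem pairingSum_empty (f : Sym2 ι → R) : pairingSum f ∅ = 1 := by
  simp [pairingSum, pairingsOn_empty]

variable [DecidableEq ι]

theorem insert_mem_pairingsOn {A : Finset ι} {a j : ι} (ha : a ∉ A) (hj : j ∈ A)
    {M : Finset (Sym2 ι)} (hM : M ∈ pairingsOn (A.erase j)) :
    insert s(a, j) M ∈ pairingsOn (insert a A) := by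
  rw [mem_pairingsOn] at hM ⊢
  obtain ⟨h1, h2⟩ := hM
  have haj : a ≠ j := by rintro rfl; exact ha hj
  refine ⟨fun e he => ?_, fun i hi => ?_⟩
  · rcases Finset.mem_insert.1 he with rfl | he
    · refine ⟨by simpa using haj, fun i hi => ?_⟩
      rcases Sym2.mem_iff.1 hi with rfl | rfl
      · simp
      · simp [hj]
    · exact ⟨(h1 e he).1, fun i hi =>
        Finset.mem_insert_of_mem (Finset.mem_of_mem_erase ((h1 e he).2 i hi))⟩
  · by_cases hij : i = a ∨ i = j
    · refine ⟨s(a, j), ⟨Finset.mem_insert_self _ _, Sym2.mem_iff.2 hij⟩, ?_⟩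
      rintro e ⟨he, hie⟩
      rcases Finset.mem_insert.1 he with rfl | he
      · rfl
      · have := (h1 e he).2 i hie
        rcases hij with rfl | rfl
        · exact absurd (Finset.mem_of_mem_erase this) ha
        · simp at this
    · push Not at hij
      obtain ⟨e, ⟨he, hie⟩, hu⟩ := h2 i (by
        rw [Finset.mem_erase]; exact ⟨hij.2, (Finset.mem_insert.1 hi).resolve_left hij.1⟩)
      refine ⟨e, ⟨Finset.mem_insert_of_mem he, hie⟩, ?_⟩
      rintro e' ⟨he', hie'⟩
      rcases Finset.mem_insert.1 he' with rfl | he'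
      · rcases Sym2.mem_iff.1 hie' with h | h
        · exact absurd h hij.1
        · exact absurd h hij.2
      · exact hu e' ⟨he', hie'⟩

theorem erase_mem_pairingsOn {A : Finset ι} {a j : ι} (ha : a ∉ A)
    {M : Finset (Sym2 ι)} (hM : M ∈ pairingsOn (insert a A)) (hj : s(a, j) ∈ M) :
    M.erase s(a, j) ∈ pairingsOn (A.erase j) := by
  rw [mem_pairingsOn] at hM ⊢
  obtain ⟨h1, h2⟩ := hM
  refine ⟨fun e he => ?_, fun i hi => ?_⟩
  · obtain ⟨hne, heM⟩ := Finset.mem_erase.1 he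
    refine ⟨(h1 e heM).1, fun i hi => ?_⟩
    have hi' := (h1 e heM).2 i hi
    rw [Finset.mem_erase]
    refine ⟨?_, (Finset.mem_insert.1 hi').resolve_left ?_⟩
    · rintro rfl
      exact hne ((h2 i hi').unique ⟨heM, hi⟩ ⟨hj, by simp⟩)
    · rintro rfl
      exact hne ((h2 i hi').unique ⟨heM, hi⟩ ⟨hj, by simp⟩)
  · obtain ⟨hij, hi⟩ := Finset.mem_erase.1 hi
    obtain ⟨e, ⟨he, hie⟩, hu⟩ := h2 i (Finset.mem_insert_of_mem hi)
    refine ⟨e, ⟨Finset.mem_erase.2 ⟨?_, he⟩, hie⟩, fun e' he' =>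
      hu e' ⟨Finset.mem_of_mem_erase he'.1, he'.2⟩⟩
    rintro rfl
    rcases Sym2.mem_iff.1 hie with rfl | rfl
    · exact ha hi
    · exact hij rfl

/-- Sorting the pairings of `A ∪ {a}` by the partner of `a`. -/
theorem pairingsOn_insert {A : Finset ι} {a : ι} (ha : a ∉ A) :
    pairingsOn (insert a A) =
      A.biUnion fun j => (pairingsOn (A.erase j)).image (insert s(a, j)) := by
  ext M
  simp only [Finset.mem_biUnion, Finset.mem_image]
  constructor
  · intro hM
    obtain ⟨h1, h2⟩ := mem_pairingsOn.1 hM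
    obtain ⟨e, ⟨he, hae⟩, -⟩ := h2 a (Finset.mem_insert_self _ _)
    obtain ⟨j, rfl⟩ := Sym2.mem_iff_exists.1 hae
    have hjA : j ∈ A := by
      refine (Finset.mem_insert.1 ((h1 _ he).2 j (by simp))).resolve_left ?_
      rintro rfl
      exact (h1 _ he).1 (by simp)
    exact ⟨j, hjA, _, erase_mem_pairingsOn ha hM he, Finset.insert_erase he⟩
  · rintro ⟨j, hj, M, hM, rfl⟩
    exact insert_mem_pairingsOn ha hj hM

/-- Expansion of a sum over pairings along the partner of a fixed element. -/
theorem pairingSum_insert (f : Sym2 ι → R) {A : Finset ι} {a : ι} (ha : a ∉ A) :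
    pairingSum f (insert a A) = ∑ j ∈ A, f s(a, j) * pairingSum f (A.erase j) := by
  have hae : ∀ j, a ∉ A.erase j := fun j h => ha (Finset.mem_of_mem_erase h)
  rw [pairingSum, pairingsOn_insert ha, Finset.sum_biUnion]
  · refine Finset.sum_congr rfl fun j _ => ?_
    rw [Finset.sum_image, pairingSum, Finset.mul_sum]
    · exact Finset.sum_congr rfl fun M hM =>
        Finset.prod_insert (notMem_of_mem_pairingsOn (hae j) hM)
    · intro M hM N hN h
      rw [← Finset.erase_insert (notMem_of_mem_pairingsOn (j := j) (hae j) hM),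
        ← Finset.erase_insert (notMem_of_mem_pairingsOn (j := j) (hae j) hN)]
      exact congrArg (fun L => L.erase s(a, j)) h
  · intro j _ k _ hjk
    refine Finset.disjoint_left.2 fun M hMj hMk => hjk ?_
    obtain ⟨N, hN, rfl⟩ := Finset.mem_image.1 hMj
    obtain ⟨N', hN', h⟩ := Finset.mem_image.1 hMk
    have hk : s(a, k) ∈ insert s(a, j) N := h ▸ Finset.mem_insert_self _ _
    rcases Finset.mem_insert.1 hk with h' | h'
    · exact (Sym2.congr_right.1 h').symm
    · exact absurd h' (notMem_of_mem_pairingsOn (hae j) hN)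

theorem pairingSum_of_odd (f : Sym2 ι → R) {A : Finset ι} (hA : Odd A.card) :
    pairingSum f A = 0 := by
  induction A using Finset.strongInduction with
  | H A ih =>
    obtain ⟨a, haA⟩ := Finset.card_pos.1 hA.pos
    obtain ⟨B, haB, rfl⟩ := exists_insert_eq haA
    rw [pairingSum_insert f haB]
    refine Finset.sum_eq_zero fun j hj => ?_
    rw [ih, mul_zero]
    · exact ((Finset.erase_ssubset hj).trans (Finset.ssubset_insert haB))
    · have := Finset.card_erase_add_one hj
      rw [Finset.card_insert_of_notMem haB] at hA
      grind

/-- In a pairing of a set of `2 * n` elements there are `n` pairs, and each element occurs in one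
of them, so factors attached to the pairs and to the elements can be pulled out. -/
theorem pairingSum_scale (f g : Sym2 ι → R) (c : R) (x : ι → R)
    (hfg : ∀ i j, f s(i, j) = c * (x i * x j) * g s(i, j)) (n : ℕ) {A : Finset ι}
    (hA : A.card = 2 * n) :
    pairingSum f A = c ^ n * (∏ i ∈ A, x i) * pairingSum g A := by
  induction n generalizing A with
  | zero =>
    obtain rfl : A = ∅ := Finset.card_eq_zero.1 (by simpa using hA)
    simp [pairingSum_empty]
  | succ n ih =>
    obtain ⟨a, haA⟩ := Finset.card_pos.1 (by omega : 0 < A.card)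
    obtain ⟨B, haB, rfl⟩ := exists_insert_eq haA
    rw [Finset.card_insert_of_notMem haB] at hA
    rw [pairingSum_insert f haB, pairingSum_insert g haB, Finset.prod_insert haB,
      Finset.mul_sum]
    refine Finset.sum_congr rfl fun j hj => ?_
    have := Finset.card_erase_add_one hj
    rw [ih (by omega), hfg, ← Finset.mul_prod_erase B x hj]
    ring

end Pairings

/-! ### The shifted permanent and its recursion -/

section ShiftedPerm

variable {ι K : Type*} [DecidableEq ι] [Field K]

/-- The matrix `[x_{j,k}]` with an indeterminate added to every entry. -/
noncomputable def shiftedEntry (x : ι → K) (j k : ι) : K[X] := C (quotientMatrix x j k) + X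

/-- The quantity `-4 x_i x_j / (x_i - x_j) ^ 2` attached to the pair `{i, j}`. For `i ≠ j`
the contribution `x_{i,j} x_{j,i}` of a transposition to the permanent is `-1` plus this weight. -/
def cycleWeight (x : ι → K) (e : Sym2 ι) : K :=
  Sym2.lift ⟨fun i j => -4 * (x i * x j) * (1 / (x i - x j) ^ 2), fun i j => by
    simp only [sub_sq_comm (x i) (x j), mul_comm (x i) (x j)]⟩ e

/-- The addition formula for `coth` in algebraic form, together with its degenerate case
`j = k`. -/
theorem shiftedEntry_mul_shiftedEntry {x : ι → K} (hx : Function.Injective x) {a j k : ι}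
    (hj : j ≠ a) (hk : k ≠ a) :
    shiftedEntry x a k * shiftedEntry x j a =
      (X ^ 2 - 1) + shiftedEntry x j k * C (quotientMatrix x a k - quotientMatrix x a j) +
        if k = j then C (cycleWeight x s(a, j)) else 0 := by
  have h1 : x a - x j ≠ 0 := sub_ne_zero.2 (hx.ne hj.symm)
  have h1' : x j - x a ≠ 0 := sub_ne_zero.2 (hx.ne hj)
  have h2 : x a - x k ≠ 0 := sub_ne_zero.2 (hx.ne hk.symm)
  have hanti : quotientMatrix x j a = - quotientMatrix x a j := by
    simp only [quotientMatrix, Matrix.of_apply, if_neg hj, if_neg hj.symm]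
    field_simp
    ring
  by_cases hkj : k = j
  · subst hkj
    have h : quotientMatrix x a k * quotientMatrix x k a = -1 + cycleWeight x s(a, k) := by
      simp only [quotientMatrix, cycleWeight, Matrix.of_apply, if_neg hj, if_neg hj.symm,
        Sym2.lift_mk]
      field_simp
      ring
    have h' := congrArg (C : K → K[X]) h
    simp only [C_add, C_mul, C_neg, C_1] at h'
    rw [hanti, C_neg] at h'
    simp only [shiftedEntry, if_true, hanti, C_neg, sub_self, C_0]
    linear_combination h'
  · have h3 : x j - x k ≠ 0 := sub_ne_zero.2 (hx.ne (Ne.symm hkj))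
    have h : quotientMatrix x a k * quotientMatrix x j a =
        -1 + quotientMatrix x j k * (quotientMatrix x a k - quotientMatrix x a j) := by
      simp only [quotientMatrix, Matrix.of_apply, if_neg hj, if_neg hj.symm, if_neg hk.symm,
        if_neg (Ne.symm hkj)]
      field_simp
      ring
    have h' := congrArg (C : K → K[X]) h
    simp only [C_add, C_mul, C_neg, C_1, C_sub] at h'
    rw [hanti, C_neg] at h'
    simp only [shiftedEntry, if_neg hkj, hanti, C_neg, C_sub]
    linear_combination h'

variable [Fintype ι]

/-- The permutations of the finite set `A`, encoded as the permutations of `ι` fixing every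
element outside `A`. -/
def permsOn (A : Finset ι) : Finset (Equiv.Perm ι) :=
  Finset.univ.filter fun σ => ∀ i ∉ A, σ i = i

/-- The permanent over `A` of the matrix `[x_{j,k} + t]`, a polynomial in `t`. -/
noncomputable def shiftedPerm (x : ι → K) (A : Finset ι) : K[X] :=
  ∑ σ ∈ permsOn A, ∏ i ∈ A, shiftedEntry x i (σ i)

theorem mem_permsOn {A : Finset ι} {σ : Equiv.Perm ι} :
    σ ∈ permsOn A ↔ ∀ i ∉ A, σ i = i := by
  simp [permsOn]

theorem apply_mem_iff_of_mem_permsOn {A : Finset ι} {σ : Equiv.Perm ι} (hσ : σ ∈ permsOn A)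
    (i : ι) : σ i ∈ A ↔ i ∈ A := by
  rw [mem_permsOn] at hσ
  constructor
  · intro h
    by_contra hi
    exact hi (hσ i hi ▸ h)
  · intro h
    by_contra hi
    exact hi (by rwa [σ.injective (hσ _ hi)])

theorem permsOn_erase {A : Finset ι} (j : ι) :
    permsOn (A.erase j) = (permsOn A).filter fun σ => σ j = j := by
  ext σ
  simp only [mem_permsOn, Finset.mem_filter, Finset.mem_erase]
  constructor
  · exact fun h => ⟨fun i hi => h i (by tauto), h j (by tauto)⟩
  · rintro ⟨h, hj⟩ i hi
    by_cases hij : i = j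
    · rw [hij, hj]
    · exact h i (by tauto)

/-- Each permutation of `A ∪ {a}` is `σ * swap a j` for a unique permutation `σ` of `A` and a
unique `j`, the preimage of `a`. -/
theorem sum_permsOn_insert {R : Type*} [AddCommMonoid R] {A : Finset ι} {a : ι} (ha : a ∉ A)
    (f : Equiv.Perm ι → R) :
    ∑ τ ∈ permsOn (insert a A), f τ =
      ∑ σ ∈ permsOn A, ∑ j ∈ insert a A, f (σ * Equiv.swap a j) := by
  rw [← Finset.sum_product']
  symm
  refine Finset.sum_bij' (fun p _ => p.1 * Equiv.swap a p.2)
    (fun τ _ => (τ * Equiv.swap a (τ⁻¹ a), τ⁻¹ a)) ?_ ?_ ?_ ?_ ?_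
  · rintro ⟨σ, j⟩ h
    obtain ⟨hσ, hj⟩ := Finset.mem_product.1 h
    rw [mem_permsOn] at hσ ⊢
    intro i hi
    have hia : i ≠ a := by rintro rfl; simp at hi
    have hij : i ≠ j := by rintro rfl; exact hi hj
    rw [Equiv.Perm.mul_apply, Equiv.swap_apply_of_ne_of_ne hia hij]
    exact hσ i fun h => hi (Finset.mem_insert_of_mem h)
  · intro τ hτ
    rw [Finset.mem_product]
    have hj : τ⁻¹ a ∈ insert a A := by
      rw [← apply_mem_iff_of_mem_permsOn hτ]
      simp
    refine ⟨?_, hj⟩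
    rw [mem_permsOn] at hτ ⊢
    intro i hi
    by_cases hia : i = a
    · simp [hia]
    · have hij : i ≠ τ⁻¹ a := by
        rintro rfl
        exact hi ((Finset.mem_insert.1 hj).resolve_left hia)
      rw [Equiv.Perm.mul_apply, Equiv.swap_apply_of_ne_of_ne hia hij]
      exact hτ i (by simp [hia, hi])
  · rintro ⟨σ, j⟩ h
    have hσ := mem_permsOn.1 (Finset.mem_product.1 h).1 a ha
    have : (σ * Equiv.swap a j)⁻¹ a = j := by
      rw [Equiv.Perm.inv_eq_iff_eq]
      simp [hσ]
    simp only [this, mul_assoc, Equiv.swap_mul_self, mul_one]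
  · intro τ _
    simp [mul_assoc]
  · intro p _
    rfl

theorem derivative_shiftedPerm (x : ι → K) (A : Finset ι) :
    derivative (shiftedPerm x A) =
      ∑ σ ∈ permsOn A, ∑ j ∈ A, ∏ i ∈ A.erase j, shiftedEntry x i (σ i) := by
  simp [shiftedPerm, derivative_prod_finset, shiftedEntry]

/-- The recursion obtained by inserting a new element `a` into the cycles of the permutations
of `A`. -/
theorem shiftedPerm_insert {x : ι → K} (hx : Function.Injective x) {A : Finset ι} {a : ι}
    (ha : a ∉ A) :
    shiftedPerm x (insert a A) =
      (1 + X) * shiftedPerm x A + (X ^ 2 - 1) * derivative (shiftedPerm x A) +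
        ∑ j ∈ A, C (cycleWeight x s(a, j)) * shiftedPerm x (A.erase j) := by
  have hne : ∀ {i}, i ∈ A → i ≠ a := by rintro i hi rfl; exact ha hi
  have key : ∀ σ ∈ permsOn A,
      ∑ j ∈ insert a A, ∏ i ∈ insert a A, shiftedEntry x i ((σ * Equiv.swap a j) i) =
        (1 + X) * ∏ i ∈ A, shiftedEntry x i (σ i) +
          (X ^ 2 - 1) * ∑ j ∈ A, ∏ i ∈ A.erase j, shiftedEntry x i (σ i) +
          ∑ j ∈ A, if σ j = j then
            C (cycleWeight x s(a, j)) * ∏ i ∈ A.erase j, shiftedEntry x i (σ i) else 0 := by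
    intro σ hσ
    have hσA := apply_mem_iff_of_mem_permsOn hσ
    have hσa : σ a = a := mem_permsOn.1 hσ a ha
    have hterm : ∀ j ∈ A,
        ∏ i ∈ insert a A, shiftedEntry x i ((σ * Equiv.swap a j) i) =
          (X ^ 2 - 1) * ∏ i ∈ A.erase j, shiftedEntry x i (σ i) +
          (∏ i ∈ A, shiftedEntry x i (σ i)) *
            (C (quotientMatrix x a (σ j)) - C (quotientMatrix x a j)) +
          if σ j = j then
            C (cycleWeight x s(a, j)) * ∏ i ∈ A.erase j, shiftedEntry x i (σ i) else 0 := by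
      intro j hj
      have hrest : ∏ i ∈ A.erase j, shiftedEntry x i ((σ * Equiv.swap a j) i) =
          ∏ i ∈ A.erase j, shiftedEntry x i (σ i) := by
        refine Finset.prod_congr rfl fun i hi => ?_
        obtain ⟨hij, hi⟩ := Finset.mem_erase.1 hi
        rw [Equiv.Perm.mul_apply, Equiv.swap_apply_of_ne_of_ne (hne hi) hij]
      rw [Finset.prod_insert ha, ← Finset.mul_prod_erase A _ hj, hrest, ← mul_assoc,
        ← Finset.mul_prod_erase A (fun i => shiftedEntry x i (σ i)) hj]
      simp only [Equiv.Perm.mul_apply, Equiv.swap_apply_left, Equiv.swap_apply_right, hσa]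
      rw [shiftedEntry_mul_shiftedEntry hx (hne hj) (hne ((hσA j).2 hj)), C_sub]
      split_ifs <;> ring
    -- The differences cancel because `σ` permutes `A`.
    have hcancel : ∑ j ∈ A, (C (quotientMatrix x a (σ j)) - C (quotientMatrix x a j)) = 0 := by
      rw [Finset.sum_sub_distrib, sub_eq_zero]
      exact Finset.sum_equiv σ (fun i => (hσA i).symm) fun _ _ => rfl
    have hfix : ∏ i ∈ insert a A, shiftedEntry x i ((σ * Equiv.swap a a) i) =
        (1 + X) * ∏ i ∈ A, shiftedEntry x i (σ i) := by
      rw [Equiv.swap_self, Finset.prod_insert ha]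
      simp [← Equiv.Perm.one_def, hσa, shiftedEntry, quotientMatrix]
    rw [Finset.sum_insert ha, hfix, Finset.sum_congr rfl hterm, Finset.sum_add_distrib,
      Finset.sum_add_distrib, ← Finset.mul_sum, ← Finset.mul_sum, hcancel]
    ring
  have hlast : ∀ j ∈ A, C (cycleWeight x s(a, j)) * shiftedPerm x (A.erase j) =
      ∑ σ ∈ permsOn A, if σ j = j then
        C (cycleWeight x s(a, j)) * ∏ i ∈ A.erase j, shiftedEntry x i (σ i) else 0 := by
    intro j _
    rw [shiftedPerm, permsOn_erase, Finset.mul_sum, Finset.sum_filter]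
  rw [derivative_shiftedPerm, Finset.sum_congr rfl hlast,
    Finset.sum_comm (s := A) (t := permsOn A) (f := fun j σ => if σ j = j then
      C (cycleWeight x s(a, j)) * ∏ i ∈ A.erase j, shiftedEntry x i (σ i) else 0),
    shiftedPerm, sum_permsOn_insert ha, Finset.sum_congr rfl key, Finset.sum_add_distrib,
    Finset.sum_add_distrib, ← Finset.mul_sum, ← Finset.mul_sum, shiftedPerm]

/-! ### Evaluation of the permanent -/

/-- The shifted permanent is the sum over pairings up to a multiple of `1 + X`, and the cofactor
contains only powers of `X` of parity opposite to that of `#A`. -/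
theorem exists_shiftedPerm_eq {x : ι → K} (hx : Function.Injective x) (A : Finset ι) :
    ∃ F : K[X], shiftedPerm x A = C (pairingSum (cycleWeight x) A) + (1 + X) * F ∧
      ∀ k, Even (k + A.card) → F.coeff k = 0 := by
  induction A using Finset.strongInduction with
  | H A ih =>
    rcases A.eq_empty_or_nonempty with rfl | ⟨a, haA⟩
    · refine ⟨0, ?_, by simp⟩
      have : permsOn (∅ : Finset ι) = {1} := by
        ext σ
        simp [mem_permsOn, Equiv.ext_iff]
      simp [shiftedPerm, this, pairingSum_empty]
    · obtain ⟨B, haB, rfl⟩ := exists_insert_eq haA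
      obtain ⟨F, hF, hFc⟩ := ih B (Finset.ssubset_insert haB)
      have ih' : ∀ j, ∃ G : K[X], j ∈ B → (shiftedPerm x (B.erase j) =
          C (pairingSum (cycleWeight x) (B.erase j)) + (1 + X) * G ∧
            ∀ k, Even (k + (B.erase j).card) → G.coeff k = 0) := by
        intro j
        by_cases hj : j ∈ B
        · obtain ⟨G, hG⟩ :=
            ih (B.erase j) ((Finset.erase_ssubset hj).trans (Finset.ssubset_insert haB))
          exact ⟨G, fun _ => hG⟩
        · exact ⟨0, fun h => absurd h hj⟩
      choose G hG using ih'
      -- `(1 + X)² F + (X² - 1) ((1 + X) F)' = (1 + X) (2 X F + (X² - 1) F')`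
      refine ⟨C (pairingSum (cycleWeight x) B) + 2 * (X * F) +
        (X * (X * derivative F) - derivative F) +
          ∑ j ∈ B, C (cycleWeight x s(a, j)) * G j, ?_, ?_⟩
      · rw [shiftedPerm_insert hx haB, pairingSum_insert _ haB, hF,
          Finset.sum_congr rfl fun j hj => by rw [(hG j hj).1]]
        simp only [mul_add, Finset.sum_add_distrib, map_sum, C_mul, derivative_add,
          derivative_C, derivative_mul, derivative_one, derivative_X, Finset.mul_sum]
        have : ∑ j ∈ B, C (cycleWeight x s(a, j)) * ((1 + X) * G j) =
            (1 + X) * ∑ j ∈ B, C (cycleWeight x s(a, j)) * G j := by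
          rw [Finset.mul_sum]
          exact Finset.sum_congr rfl fun j _ => by ring
        rw [this, ← Finset.mul_sum]
        ring
      · intro k hk
        rw [Finset.card_insert_of_notMem haB] at hk
        have hsum : (∑ j ∈ B, C (cycleWeight x s(a, j)) * G j).coeff k = 0 := by
          rw [finsetSum_coeff]
          refine Finset.sum_eq_zero fun j hj => ?_
          have := Finset.card_erase_add_one hj
          rw [coeff_C_mul, (hG j hj).2 k (by grind), mul_zero]
        have hd : (derivative F).coeff k = 0 := by
          rw [coeff_derivative, hFc _ (by grind), zero_mul]
        have hX : (X * F).coeff k = 0 := by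
          rcases k with _ | k
          · simp
          · rw [coeff_X_mul, hFc k (by grind)]
        have hXX : (X * (X * derivative F)).coeff k = 0 := by
          rcases k with _ | _ | k
          · simp
          · simp
          · rw [coeff_X_mul, coeff_X_mul, coeff_derivative, hFc _ (by grind), zero_mul]
        have hC : (C (pairingSum (cycleWeight x) B)).coeff k = 0 := by
          rcases k with _ | k
          · rw [pairingSum_of_odd _ (by grind)]
            simp
          · exact coeff_C_succ
        rw [two_mul]
        simp only [coeff_add, coeff_sub, hsum, hd, hX, hXX, hC]
        simp

theorem eval_zero_shiftedPerm_univ (x : ι → K) :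
    (shiftedPerm x Finset.univ).eval 0 = permS x := by
  rw [permS, ← Matrix.permanent_transpose]
  simp [shiftedPerm, permsOn, shiftedEntry, eval_finsetSum, eval_prod, Matrix.permanent]

/-- The evaluation of the permanent at pairwise distinct elements of a field. -/
theorem permS_eq_of_injective {x : ι → K} (hx : Function.Injective x) {n : ℕ}
    (hι : Fintype.card ι = 2 * n) :
    permS x = (-4) ^ n * (∏ i, x i) * ∑ M ∈ pairings ι, ∏ e ∈ M, pairWeight x e := by
  obtain ⟨F, hF, hFc⟩ := exists_shiftedPerm_eq hx (Finset.univ : Finset ι)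
  have hF0 : F.eval 0 = 0 := by
    rw [← coeff_zero_eq_eval_zero]
    exact hFc 0 (by simp [hι])
  rw [← pairingsOn_univ, ← eval_zero_shiftedPerm_univ, hF]
  simp only [eval_add, eval_C, eval_mul, hF0, mul_zero, add_zero]
  exact pairingSum_scale _ _ (-4) x (fun i j => by simp [cycleWeight, pairWeight]) n hι

end ShiftedPerm

theorem ratVar_injective (F : Type*) [Field F] (m : ℕ) : Function.Injective (ratVar F m) :=
  (IsFractionRing.injective (MvPolynomial (Fin m) F) _).comp MvPolynomial.X_injective

/-- The first part is the identity between rational functions in `2n` variables over an arbitrary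
field; the second is the identity between the values at any `2n` distinct points of the field. -/
theorem theorem1p1 (F : Type*) [Field F] (n : ℕ) (hn : 0 < n) :
    permS (ratVar F (2 * n)) =
      (-4) ^ n * (∏ i, ratVar F (2 * n) i) *
        ∑ M ∈ pairings (Fin (2 * n)), ∏ e ∈ M, pairWeight (ratVar F (2 * n)) e ∧
    ∀ x : Fin (2 * n) → F, Function.Injective x →
      permS x =
        (-4) ^ n * (∏ i, x i) *
          ∑ M ∈ pairings (Fin (2 * n)), ∏ e ∈ M, pairWeight x e :=
  ⟨permS_eq_of_injective (ratVar_injective F _) (Fintype.card_fin _),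
    fun _ hx => permS_eq_of_injective hx (Fintype.card_fin _)⟩
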